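/- Let $S$ and $A$ be finite sets ($A\neq\emptyset$), let $P^o=(P^o_{s,a})_{s\in S,a\in A}$ be a family of probability distributions on $S$ (the nominal model), and let $c_r>0$. For probability vectors $p,q$ on $S$ let $D_{\mathrm{kl}}(p,q)=\sum_{s'}p(s')\log\frac{p(s')}{q(s')}$ (with $0\log 0=0$, and $+\infty$ if $q(s')=0<p(s')$ for some $s'$), and let $\mathcal P=\bigotimes_{s,a}\mathcal P_{s,a}$ with $\mathcal P_{s,a}=\{p : D_{\mathrm{kl}}(p,P^o_{s,a})\le c_r\}$ be the KL uncertainty set. Then there is a constant $\lambda_{\mathrm{kl}}>0$, depending only on the nominal model $P^o$ and on $c_r$, such that the following holds for every discount factor $\gamma\in(0,1)$, every reward function $r:S\times A\to[0,1]$, every $\delta\in(0,1)$, every $\epsilon\in(0,1/(1-\gamma))$, and all natural numbers $K\ge K_0$ and $N\ge N^{\mathrm{kl}}$, where $$K_0=\frac{1}{\log(1/\gamma)}\log\Big(\frac{\max\{8\gamma,2\}}{\epsilon(1-\gamma)^2}\Big),\qquad N^{\mathrm{kl}}=\frac{8\gamma^2|S|}{c_r^2(1-\gamma)^4\epsilon^2}\exp\Big(\frac{2\lambda_{\mathrm{kl}}+4}{\lambda_{\mathrm{kl}}(1-\gamma)}\Big)\log\Big(\frac{9|S||A|}{\delta\lambda_{\mathrm{kl}}(1-\gamma)}\Big).$$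 For a deterministic policy $\pi:S\to A$ and a model $P$ let $V_{\pi,P}(s)=\mathbb E_{\pi,P}\big[\sum_{t\ge0}\gamma^t r(s_t,a_t)\mid s_0=s\big]$ with $a_t=\pi(s_t)$, $s_{t+1}\sim P_{s_t,a_t}$, and let $V^\pi(s)=\inf_{P\in\mathcal P}V_{\pi,P}(s)$ and $V^*(s)=\sup_\pi V^\pi(s)$. Draw independent samples, $N$ from each $P^o_{s,a}$; let $\widehat P_{s,a}(s')$ be the fraction of the $N$ samples from $P^o_{s,a}$ that equal $s'$, and let $\widehat{\mathcal P}_{s,a}$ be the set of probability vectors $p$ with $D_{\mathrm{kl}}(p,\widehat P_{s,a})\le c_r$. The algorithm REVI (robust empirical value iteration) starts from $Q_0=0$, computes for $k=0,\dots,K-1$ $$V_k(s)=\max_a Q_k(s,a),\qquad Q_{k+1}(s,a)=r(s,a)+\gamma\inf\{u^\top V_k : u\in\widehat{\mathcal P}_{s,a}\},$$ and outputs a policy $\pi_K$ with $\pi_K(s)\in\arg\max_a Q_K(s,a)$ for all $s$. Then, with probability at least $1-2\delta$, every such output $\pi_K$ satisfies $\|V^*-V^{\pi_K}\|_\infty\le\epsilon$.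 -/

import Mathlib

open MeasureTheory ProbabilityTheory

namespace RobustMDP

/-- Distributions on a finite set `S`, as vectors. -/
abbrev Dist (S : Type*) [Fintype S] : Type _ := stdSimplex ℝ S

/-- A transition model: `P s a s'` is the probability of moving to `s'` when action `a` is taken
at state `s`. -/
abbrev Model (S A : Type*) [Fintype S] : Type _ := S → A → Dist S

section Value

variable {S A : Type*} [Fintype S] [MeasurableSpace S]

/-- The measure on `S` with point masses `p s`. -/
noncomputable def Dist.measure (p : Dist S) : Measure S :=
  ∑ s, ENNReal.ofReal (p s) • Measure.dirac s

instance Dist.isProbabilityMeasure_measure (p : Dist S) : IsProbabilityMeasure p.measure := by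
  constructor
  have h : ∑ s, ENNReal.ofReal (p s) = 1 := by
    rw [← ENNReal.ofReal_sum_of_nonneg (f := fun s => p s) (fun s _ => p.2.1 s)]
    exact (congrArg ENNReal.ofReal p.2.2).trans ENNReal.ofReal_one
  simpa [Dist.measure] using h

variable [MeasurableSingletonClass S]

/-- Given the states `s_0, …, s_n`, the next state is drawn from `P_{s_n, π(s_n)}`. -/
noncomputable def stepKernel (π : S → A) (P : Model S A) (n : ℕ) :
    Kernel (Finset.Iic n → S) S :=
  Kernel.ofFunOfCountable fun h =>
    (P (h ⟨n, Finset.mem_Iic.2 le_rfl⟩) (π (h ⟨n, Finset.mem_Iic.2 le_rfl⟩))).measure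

instance stepKernel_isMarkovKernel (π : S → A) (P : Model S A) (n : ℕ) :
    IsMarkovKernel (stepKernel π P n) :=
  ⟨fun h => Dist.isProbabilityMeasure_measure
    (P (h ⟨n, Finset.mem_Iic.2 le_rfl⟩) (π (h ⟨n, Finset.mem_Iic.2 le_rfl⟩)))⟩

/-- The law of the state trajectory `(s_0, s_1, …)` under policy `π` and model `P`, started at
`s_0 = s`. -/
noncomputable def trajLaw (π : S → A) (P : Model S A) (s : S) : Measure (ℕ → S) :=
  Kernel.traj (X := fun _ => S) (stepKernel π P) 0 (fun _ => s)

/-- The value `V_{π,P}(s)`: the expected discounted reward of policy `π` under model `P`. -/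
noncomputable def value (γ : ℝ) (r : S → A → ℝ) (π : S → A) (P : Model S A) (s : S) : ℝ :=
  ∫ ω, ∑' t : ℕ, γ ^ t * r (ω t) (π (ω t)) ∂(trajLaw π P s)

end Value

section KL

variable {S A : Type*} [Fintype S]

open scoped Classical in
/-- Kullback-Leibler divergence of two vectors of point masses, with the usual conventions:
`0 * log (0 / q) = 0`, and the value is `+∞` if `q s = 0 ≠ p s` for some `s`. -/
noncomputable def klDist (p q : S → ℝ) : EReal :=
  if ∀ s, q s = 0 → p s = 0 then ((∑ s, p s * Real.log (p s / q s) : ℝ) : EReal) else ⊤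

/-- The KL ball of radius `c` around `q`: the distributions `p` with `D_kl(p, q) ≤ c`. -/
def klBall (q : S → ℝ) (c : ℝ) : Set (S → ℝ) :=
  {p | p ∈ stdSimplex ℝ S ∧ klDist p q ≤ (c : EReal)}

/-- The rectangular uncertainty set: `P_{s,a}` ranges over the KL ball around `Po_{s,a}`,
independently for all pairs `(s, a)`. -/
def klUncertainty (Po : Model S A) (c : ℝ) : Set (Model S A) :=
  {P | ∀ s a, (P s a : S → ℝ) ∈ klBall (Po s a : S → ℝ) c}

/-- The support function `σ_B(v) = inf {uᵀ v : u ∈ B}`. -/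
noncomputable def sigma (B : Set (S → ℝ)) (v : S → ℝ) : ℝ :=
  sInf ((fun u => u ⬝ᵥ v) '' B)

end KL

section Robust

variable {S A : Type*} [Fintype S] [MeasurableSpace S] [MeasurableSingletonClass S]

/-- The robust value `V^π(s) = inf_{P ∈ 𝒫} V_{π,P}(s)`. -/
noncomputable def robustValue (γ : ℝ) (r : S → A → ℝ) (Po : Model S A) (c : ℝ)
    (π : S → A) (s : S) : ℝ :=
  ⨅ P : klUncertainty Po c, value γ r π P.1 s

/-- The optimal robust value `V^*(s) = sup_π inf_{P ∈ 𝒫} V_{π,P}(s)`. -/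
noncomputable def optRobustValue (γ : ℝ) (r : S → A → ℝ) (Po : Model S A) (c : ℝ) (s : S) : ℝ :=
  ⨆ π : S → A, robustValue γ r Po c π s

end Robust

section REVI

variable {S A : Type*} [Fintype S]

open scoped Classical in
/-- The empirical model `N(s,a,s') / N` from the samples `x s a 0, …, x s a (N - 1)`. -/
noncomputable def empirical {N : ℕ} (x : S → A → Fin N → S) (s : S) (a : A) (s' : S) : ℝ :=
  ((Finset.univ.filter fun i => x s a i = s').card : ℝ) / N

/-- The iterates of robust value iteration with KL balls around the rows of `q`:
`Q_0 = 0` and `Q_{k+1}(s,a) = r(s,a) + γ σ(V_k)` with `V_k(s) = max_a Q_k(s,a)`. -/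
noncomputable def reviQ (γ : ℝ) (r : S → A → ℝ) (q : S → A → S → ℝ) (c : ℝ) :
    ℕ → S → A → ℝ
  | 0 => fun _ _ => 0
  | k + 1 => fun s a =>
      r s a + γ * sigma (klBall (q s a) c) (fun s' => ⨆ b, reviQ γ r q c k s' b)

/-- `π(s) ∈ argmax_a Q(s,a)` for all `s`. -/
def IsGreedy (Q : S → A → ℝ) (π : S → A) : Prop :=
  ∀ s a, Q s a ≤ Q s (π s)

end REVI

section Sampling

variable {S A Ω : Type*} [Fintype S] [MeasurableSpace S] [MeasurableSpace Ω]

/-- The output of a generative model: mutually independent samples `X s a i`, `i < N`, where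
`X s a i` has law `Po_{s,a}`. -/
structure IsGenerativeSample (Po : Model S A) {N : ℕ} (μ : Measure Ω)
    (X : S → A → Fin N → Ω → S) : Prop where
  measurable : ∀ s a i, Measurable (X s a i)
  indep : iIndepFun (fun j : S × A × Fin N => X j.1 j.2.1 j.2.2) μ
  law : ∀ s a i s', μ (X s a i ⁻¹' {s'}) = ENNReal.ofReal ((Po s a : S → ℝ) s')

end Sampling

section Bounds

/-- The number of iterations
`K_0 = (1 / log (1/γ)) log (max {8γ, 2} / (ε (1-γ)²))`. -/
noncomputable def K0 (γ ε : ℝ) : ℝ :=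
  1 / Real.log (1 / γ) * Real.log (max (8 * γ) 2 / (ε * (1 - γ) ^ 2))

/-- The number of samples per state-action pair, with `nS = |S|`, `nA = |A|`. -/
noncomputable def Nkl (nS nA : ℕ) (c γ ε δ lam : ℝ) : ℝ :=
  8 * γ ^ 2 * nS / (c ^ 2 * (1 - γ) ^ 4 * ε ^ 2)
    * Real.exp ((2 * lam + 4) / (lam * (1 - γ)))
    * Real.log (9 * nS * nA / (δ * lam * (1 - γ)))

end Bounds

end RobustMDP

namespace RobustMDP

/-! ### The value of a fixed policy in a fixed model. -/

section Transition

variable {S A : Type*} [Fintype S]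

/-! The support function of a KL ball is Lipschitz in the logarithm of its centre, uniformly over
the functions it is applied to. If `q` and `q'` have the same support and `log (q / q') ≤ η` there,
then for `p` in the ball around `q` convexity of `x log x` gives D((1-t)p + tq', q') ≤ (1-t)(c + η).
So t = η/(c+η) brings `p` into the ball around `q'`, at a cost of at most ηH/c in the expectation of
a function with values in [0, H] (`sigma_klBall_le_add`). Since the bound covers all such functions
at once, no covering argument over value functions is needed, and it suffices that the empirical
rows are close to the nominal ones entry by entry. Hoeffding and a union bound over S × A × S give
this (`le_measure_empirical_close`); impossible transitions are almost surely never sampled, and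
accuracy below the least positive nominal probability m keeps the possible ones in the support.

The rest is deterministic. Comparison with the fixed point of the nominal robust Bellman operator, a
γ-contraction, turns an error Δ in the support functions into a policy error of at most (γ^K +
2γΔ)/(1-γ)² (`norm_optRobustValue_sub_le`), and `K0` and `Nkl` make each summand at most ε/2. The
constant `lam` is min(9/|S|, m, m/c). The exponential in `Nkl` serves only to dominate
(2/(lam(1-γ)))². -/

lemma dotProduct_mem_Icc {p v : S → ℝ} (hp : p ∈ stdSimplex ℝ S) {a b : ℝ}
    (hv : ∀ s, v s ∈ Set.Icc a b) : p ⬝ᵥ v ∈ Set.Icc a b := by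
  constructor
  · calc a = ∑ s, p s * a := by rw [← Finset.sum_mul, hp.2, one_mul]
      _ ≤ _ := Finset.sum_le_sum fun s _ => mul_le_mul_of_nonneg_left (hv s).1 (hp.1 s)
  · calc _ ≤ ∑ s, p s * b :=
          Finset.sum_le_sum fun s _ => mul_le_mul_of_nonneg_left (hv s).2 (hp.1 s)
      _ = b := by rw [← Finset.sum_mul, hp.2, one_mul]

/-- The transition operator of the chain induced by `π` and `P`, acting on functions. -/
noncomputable def transition (π : S → A) (P : Model S A) (f : S → ℝ) (s : S) : ℝ :=
  (P s (π s) : S → ℝ) ⬝ᵥ f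

lemma iterate_transition_mem_Icc (π : S → A) (P : Model S A) {f : S → ℝ} {a b : ℝ}
    (hf : ∀ s, f s ∈ Set.Icc a b) (t : ℕ) (s : S) :
    (transition π P)^[t] f s ∈ Set.Icc a b := by
  induction t generalizing s with
  | zero => exact hf s
  | succ t ih =>
    rw [Function.iterate_succ_apply']
    exact dotProduct_mem_Icc (P s (π s)).2 ih

end Transition

section ValueEquation

variable {S A : Type*} [Fintype S] [MeasurableSpace S] [MeasurableSingletonClass S]

lemma Dist.integral_measure (p : Dist S) (f : S → ℝ) :
    ∫ s, f s ∂p.measure = (p : S → ℝ) ⬝ᵥ f := by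
  rw [Dist.measure, integral_finsetSum_measure (fun s _ => ?_)]
  · refine Finset.sum_congr rfl fun s _ => ?_
    rw [integral_smul_measure, integral_dirac, smul_eq_mul]
    exact congrArg (· * f s) (ENNReal.toReal_ofReal (p.2.1 s))
  · exact (integrable_dirac (by simp)).smul_measure ENNReal.ofReal_ne_top

instance trajLaw_isProbabilityMeasure (π : S → A) (P : Model S A) (s : S) :
    IsProbabilityMeasure (trajLaw π P s) := by
  unfold trajLaw
  infer_instance

lemma integral_trajLaw_zero (π : S → A) (P : Model S A) (s : S) (f : S → ℝ) :
    ∫ ω, f (ω 0) ∂(trajLaw π P s) = f s := by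
  have hf : Measurable f := measurable_of_finite f
  have h := Kernel.traj_map_frestrictLe_apply (X := fun _ => S) (κ := stepKernel π P) 0 0
    (fun _ => s)
  rw [Kernel.partialTraj_self, Kernel.id_apply] at h
  have h0 : Measurable fun x : (Finset.Iic 0 → S) => f (x ⟨0, Finset.mem_Iic.2 le_rfl⟩) :=
    hf.comp (measurable_pi_apply _)
  have h2 := congrArg
    (fun m => ∫ x : (Finset.Iic 0 → S), f (x ⟨0, Finset.mem_Iic.2 le_rfl⟩) ∂m) h
  beta_reduce at h2
  rw [integral_map (by fun_prop) h0.aestronglyMeasurable,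
    integral_dirac' _ _ h0.stronglyMeasurable] at h2
  exact h2

/-- The joint law of the history up to time t and the next state is a composition product with
`stepKernel`; integrating out the last coordinate leaves a function of the state at time t. -/
lemma integral_trajLaw_succ (π : S → A) (P : Model S A) (s : S) (t : ℕ) (f : S → ℝ) :
    ∫ ω, f (ω (t + 1)) ∂(trajLaw π P s) = ∫ ω, transition π P f (ω t) ∂(trajLaw π P s) := by
  have hf : Measurable f := measurable_of_finite f
  have hg : Measurable (transition π P f) := measurable_of_finite _
  obtain ⟨C, hC⟩ : ∃ C, ∀ x, ‖f x‖ ≤ C := by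
    obtain ⟨C, hC⟩ := (Set.finite_range fun x => ‖f x‖).bddAbove
    exact ⟨C, fun x => hC ⟨x, rfl⟩⟩
  have h := Kernel.partialTraj_compProd_eq_map_traj (X := fun _ => S) (κ := stepKernel π P)
    (a := 0) (b := t) (Nat.zero_le t) (x₀ := fun _ => s)
  have hm : Measurable fun q : (Finset.Iic t → S) × S => f q.2 := hf.comp measurable_snd
  have h2 := congrArg (fun m => ∫ q : (Finset.Iic t → S) × S, f q.2 ∂m) h
  beta_reduce at h2
  rw [integral_map (by fun_prop) hm.aestronglyMeasurable, Measure.integral_compProd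
    (Integrable.of_bound hm.aestronglyMeasurable C (Filter.Eventually.of_forall fun q => hC q.2)),
    ← Kernel.traj_map_frestrictLe_apply] at h2
  have h3 : ∀ x : (Finset.Iic t → S), ∫ y, f y ∂(stepKernel π P t x)
      = transition π P f (x ⟨t, Finset.mem_Iic.2 le_rfl⟩) := fun x =>
    Dist.integral_measure _ f
  simp only [h3] at h2
  have hm' : Measurable fun x : (Finset.Iic t → S) =>
      transition π P f (x ⟨t, Finset.mem_Iic.2 le_rfl⟩) := hg.comp (measurable_pi_apply _)
  rw [integral_map (by fun_prop) hm'.aestronglyMeasurable] at h2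
  exact h2.symm

lemma integral_trajLaw (π : S → A) (P : Model S A) (s : S) (t : ℕ) (f : S → ℝ) :
    ∫ ω, f (ω t) ∂(trajLaw π P s) = (transition π P)^[t] f s := by
  induction t generalizing f with
  | zero => exact integral_trajLaw_zero π P s f
  | succ t ih => rw [integral_trajLaw_succ, ih, Function.iterate_succ_apply]

variable {γ : ℝ} {r : S → A → ℝ}

lemma value_eq_tsum (h0 : 0 ≤ γ) (h1 : γ < 1) (hr : ∀ s a, r s a ∈ Set.Icc (0 : ℝ) 1)
    (π : S → A) (P : Model S A) (s : S) :
    value γ r π P s = ∑' t : ℕ, γ ^ t * (transition π P)^[t] (fun s => r s (π s)) s := by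
  have hm : ∀ t : ℕ, Measurable fun ω : ℕ → S => γ ^ t * r (ω t) (π (ω t)) := fun t =>
    ((measurable_of_finite fun s => r s (π s)).comp (measurable_pi_apply t)).const_mul _
  have hb : ∀ (t : ℕ) (ω : ℕ → S), ‖γ ^ t * r (ω t) (π (ω t))‖ ≤ γ ^ t := fun t ω => by
    have := hr (ω t) (π (ω t))
    rw [Real.norm_of_nonneg (mul_nonneg (pow_nonneg h0 t) this.1)]
    exact mul_le_of_le_one_right (pow_nonneg h0 t) this.2
  have hi : ∀ t : ℕ, Integrable (fun ω : ℕ → S => γ ^ t * r (ω t) (π (ω t))) (trajLaw π P s) :=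
    fun t => Integrable.of_bound (hm t).aestronglyMeasurable (γ ^ t)
      (Filter.Eventually.of_forall (hb t))
  rw [value, ← integral_tsum_of_summable_integral_norm hi]
  · refine tsum_congr fun t => ?_
    rw [integral_const_mul, integral_trajLaw π P s t fun s => r s (π s)]
  · refine Summable.of_nonneg_of_le (fun t => integral_nonneg fun ω => norm_nonneg _)
      (fun t => ?_) (summable_geometric_of_lt_one h0 h1)
    refine (integral_mono (hi t).norm (integrable_const (γ ^ t)) (hb t)).trans ?_
    simp

/-- The Bellman equation for a fixed policy and model. -/
theorem value_bellman (h0 : 0 ≤ γ) (h1 : γ < 1) (hr : ∀ s a, r s a ∈ Set.Icc (0 : ℝ) 1)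
    (π : S → A) (P : Model S A) (s : S) :
    value γ r π P s = r s (π s) + γ * ((P s (π s) : S → ℝ) ⬝ᵥ value γ r π P) := by
  set f : S → ℝ := fun s => r s (π s)
  have hs : ∀ s, Summable fun t : ℕ => γ ^ t * (transition π P)^[t] f s := fun s =>
    Summable.of_nonneg_of_le
      (fun t => mul_nonneg (pow_nonneg h0 t)
        (iterate_transition_mem_Icc π P (fun s => hr s (π s)) t s).1)
      (fun t => mul_le_of_le_one_right (pow_nonneg h0 t)
        (iterate_transition_mem_Icc π P (fun s => hr s (π s)) t s).2)
      (summable_geometric_of_lt_one h0 h1)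
  have hv : value γ r π P = fun s => ∑' t : ℕ, γ ^ t * (transition π P)^[t] f s :=
    funext fun s => value_eq_tsum h0 h1 hr π P s
  simp only [hv]
  rw [(hs s).tsum_eq_zero_add]
  congr 1
  · simp [f]
  · simp only [dotProduct, ← tsum_mul_left]
    rw [← Summable.tsum_finsetSum fun i _ => (hs i).mul_left _, ← tsum_mul_left]
    refine tsum_congr fun t => ?_
    rw [Function.iterate_succ_apply', transition, dotProduct, Finset.mul_sum, Finset.mul_sum]
    refine Finset.sum_congr rfl fun i _ => ?_
    ring

lemma value_nonneg (h0 : 0 ≤ γ) (hr : ∀ s a, r s a ∈ Set.Icc (0 : ℝ) 1)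
    (π : S → A) (P : Model S A) (s : S) : 0 ≤ value γ r π P s :=
  integral_nonneg fun _ => tsum_nonneg fun t => mul_nonneg (pow_nonneg h0 t) (hr _ _).1

end ValueEquation

/-! ### Support functions of sets of distributions. -/

section Sigma

variable {S : Type*} [Fintype S] {B B' : Set (S → ℝ)}

lemma bddBelow_dotProduct_image (hB : B ⊆ stdSimplex ℝ S) (v : S → ℝ) :
    BddBelow ((fun u => u ⬝ᵥ v) '' B) := by
  obtain ⟨a, ha⟩ := (Set.finite_range v).bddBelow
  obtain ⟨b, hb⟩ := (Set.finite_range v).bddAbove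
  refine ⟨a, ?_⟩
  rintro _ ⟨u, hu, rfl⟩
  exact (dotProduct_mem_Icc (hB hu) fun s => ⟨ha ⟨s, rfl⟩, hb ⟨s, rfl⟩⟩).1

lemma sigma_le_dotProduct (hB : B ⊆ stdSimplex ℝ S) {u : S → ℝ} (hu : u ∈ B) (v : S → ℝ) :
    sigma B v ≤ u ⬝ᵥ v :=
  csInf_le (bddBelow_dotProduct_image hB v) ⟨u, hu, rfl⟩

lemma le_sigma (hne : B.Nonempty) {v : S → ℝ} {a : ℝ} (h : ∀ u ∈ B, a ≤ u ⬝ᵥ v) :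
    a ≤ sigma B v :=
  le_csInf (hne.image _) (by rintro _ ⟨u, hu, rfl⟩; exact h u hu)

lemma exists_dotProduct_lt_sigma_add (hne : B.Nonempty) (v : S → ℝ) {η : ℝ} (hη : 0 < η) :
    ∃ u ∈ B, u ⬝ᵥ v < sigma B v + η := by
  obtain ⟨_, ⟨u, hu, rfl⟩, h⟩ := Real.lt_sInf_add_pos (hne.image fun u => u ⬝ᵥ v) hη
  exact ⟨u, hu, h⟩

lemma dotProduct_le_dotProduct_add {p : S → ℝ} (hp : p ∈ stdSimplex ℝ S) {v w : S → ℝ} {k : ℝ}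
    (h : ∀ s, v s ≤ w s + k) : p ⬝ᵥ v ≤ p ⬝ᵥ w + k := by
  calc p ⬝ᵥ v ≤ ∑ s, (p s * w s + p s * k) := Finset.sum_le_sum fun s _ => by
        rw [← mul_add]; exact mul_le_mul_of_nonneg_left (h s) (hp.1 s)
    _ = _ := by rw [Finset.sum_add_distrib, ← Finset.sum_mul, hp.2, one_mul]; rfl

lemma sigma_le_sigma_add (hB : B ⊆ stdSimplex ℝ S) (hne : B.Nonempty) {v w : S → ℝ} {k : ℝ}
    (h : ∀ s, v s ≤ w s + k) : sigma B v ≤ sigma B w + k := by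
  rw [← sub_le_iff_le_add]
  refine le_sigma hne fun u hu => ?_
  rw [sub_le_iff_le_add]
  exact (sigma_le_dotProduct hB hu v).trans (dotProduct_le_dotProduct_add (hB hu) h)

lemma sigma_mem_Icc_of_nonempty (hB : B ⊆ stdSimplex ℝ S) (hne : B.Nonempty) {v : S → ℝ}
    {a b : ℝ} (hv : ∀ s, v s ∈ Set.Icc a b) : sigma B v ∈ Set.Icc a b := by
  obtain ⟨u, hu⟩ := hne
  exact ⟨le_sigma ⟨u, hu⟩ fun p hp => (dotProduct_mem_Icc (hB hp) hv).1,
    (sigma_le_dotProduct hB hu v).trans (dotProduct_mem_Icc (hB hu) hv).2⟩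

/-- The empty set is allowed because `sInf ∅ = 0`. This bounds the iterates of value iteration
without any assumption on the rows of the model. -/
lemma sigma_mem_Icc (hB : B ⊆ stdSimplex ℝ S) {v : S → ℝ} {H : ℝ} (hH : 0 ≤ H)
    (hv : ∀ s, v s ∈ Set.Icc 0 H) : sigma B v ∈ Set.Icc 0 H := by
  rcases B.eq_empty_or_nonempty with rfl | hne
  · simp [sigma, hH]
  · exact sigma_mem_Icc_of_nonempty hB hne hv

lemma sigma_le_sigma_add_of_forall_exists (hB' : B' ⊆ stdSimplex ℝ S) (hne : B.Nonempty)
    {v : S → ℝ} {d : ℝ} (h : ∀ u ∈ B, ∃ u' ∈ B', u' ⬝ᵥ v ≤ u ⬝ᵥ v + d) :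
    sigma B' v ≤ sigma B v + d := by
  rw [← sub_le_iff_le_add]
  refine le_sigma hne fun u hu => ?_
  obtain ⟨u', hu', h'⟩ := h u hu
  rw [sub_le_iff_le_add]
  exact (sigma_le_dotProduct hB' hu' v).trans h'

end Sigma

/-! ### Perturbing the centre of a KL ball. -/

section KLBall

variable {S : Type*} [Fintype S] {p q q' : S → ℝ} {c : ℝ}

lemma klBall_subset (q : S → ℝ) (c : ℝ) : klBall q c ⊆ stdSimplex ℝ S := fun _ hp => hp.1

lemma mem_klBall_iff : p ∈ klBall q c ↔ p ∈ stdSimplex ℝ S ∧ (∀ s, q s = 0 → p s = 0) ∧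
    ∑ s, p s * Real.log (p s / q s) ≤ c := by
  unfold klBall klDist
  rw [Set.mem_ofPred_eq]
  split_ifs with h
  · rw [EReal.coe_le_coe_iff]
    exact ⟨fun h' => ⟨h'.1, h, h'.2⟩, fun h' => ⟨h'.1, h'.2.2⟩⟩
  · simp only [top_le_iff, EReal.coe_ne_top, and_false, false_iff]
    exact fun h' => h h'.2.1

lemma self_mem_klBall (hq : q ∈ stdSimplex ℝ S) (hc : 0 ≤ c) : q ∈ klBall q c := by
  refine mem_klBall_iff.2 ⟨hq, fun _ h => h, ?_⟩
  refine le_of_eq_of_le (Finset.sum_eq_zero fun s _ => ?_) hc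
  by_cases h : q s = 0
  · simp [h]
  · simp [div_self h]

/-- Moving the centre of a KL ball perturbs its points only slightly, provided that the two
centres have the same support. -/
lemma lineMap_mem_klBall (hp : p ∈ klBall q c)
    (hq' : q' ∈ stdSimplex ℝ S) (hsupp : ∀ s, q s = 0 ↔ q' s = 0) {η t : ℝ}
    (hlog : ∀ s, q s ≠ 0 → Real.log (q s / q' s) ≤ η) (ht0 : 0 ≤ t) (ht1 : t ≤ 1)
    (ht : (1 - t) * (c + η) ≤ c) :
    (1 - t) • p + t • q' ∈ klBall q' c := by
  obtain ⟨hps, hp0, hpc⟩ := mem_klBall_iff.1 hp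
  refine mem_klBall_iff.2 ⟨convex_stdSimplex ℝ S hps hq' (by linarith) ht0 (by ring),
    fun s hs => by simp [hs, hp0 s ((hsupp s).2 hs)], ?_⟩
  have hterm : ∀ s, ((1 - t) • p + t • q') s * Real.log (((1 - t) • p + t • q') s / q' s)
      ≤ (1 - t) * (p s * Real.log (p s / q s) + p s * η) := by
    intro s
    simp only [Pi.add_apply, Pi.smul_apply, smul_eq_mul]
    by_cases hs : q' s = 0
    · simp [hs, hp0 s ((hsupp s).2 hs)]
    have hqs : q s ≠ 0 := fun h => hs ((hsupp s).1 h)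
    have hq'pos : 0 < q' s := lt_of_le_of_ne (hq'.1 s) (Ne.symm hs)
    -- Convexity of x log x between p/q' and 1, where it vanishes: mixing with the centre scales the
    -- divergence by at most 1 - t.
    have hconv := Real.convexOn_mul_log.2
      (Set.mem_Ici.2 (div_nonneg (hps.1 s) hq'pos.le))
      (Set.mem_Ici.2 (zero_le_one (α := ℝ)))
      (show 0 ≤ 1 - t by linarith) ht0 (by ring)
    simp only [smul_eq_mul, mul_one, Real.log_one, mul_zero, add_zero] at hconv
    have he : (1 - t) * (p s / q' s) + t = ((1 - t) * p s + t * q' s) / q' s := by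
      field_simp
    rw [he] at hconv
    have h1 := mul_le_mul_of_nonneg_left hconv hq'pos.le
    have h2 : q' s * (((1 - t) * p s + t * q' s) / q' s *
        Real.log (((1 - t) * p s + t * q' s) / q' s)) =
        ((1 - t) * p s + t * q' s) * Real.log (((1 - t) * p s + t * q' s) / q' s) := by
      field_simp
    have h3 : q' s * ((1 - t) * (p s / q' s * Real.log (p s / q' s))) =
        (1 - t) * (p s * Real.log (p s / q' s)) := by
      field_simp
    rw [h2, h3] at h1
    refine h1.trans (mul_le_mul_of_nonneg_left ?_ (by linarith))
    by_cases hp' : p s = 0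
    · simp [hp']
    rw [← mul_add]
    refine mul_le_mul_of_nonneg_left ?_ (hps.1 s)
    -- Change of centre: this splits the logarithm, and the second factor contributes at most η.
    have : p s / q' s = p s / q s * (q s / q' s) := by field_simp
    rw [this, Real.log_mul (div_ne_zero hp' hqs) (div_ne_zero hqs hs)]
    linarith [hlog s hqs]
  calc _ ≤ ∑ s, (1 - t) * (p s * Real.log (p s / q s) + p s * η) :=
        Finset.sum_le_sum fun s _ => hterm s
    _ = (1 - t) * (∑ s, p s * Real.log (p s / q s) + η) := by
        rw [← Finset.mul_sum, Finset.sum_add_distrib, ← Finset.sum_mul, hps.2, one_mul]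
    _ ≤ (1 - t) * (c + η) := mul_le_mul_of_nonneg_left (by linarith) (by linarith)
    _ ≤ c := ht

/-- Lipschitz dependence of the support function of a KL ball on the logarithm of its centre. -/
theorem sigma_klBall_le_add (hc : 0 < c) (hq : q ∈ stdSimplex ℝ S) (hq' : q' ∈ stdSimplex ℝ S)
    (hsupp : ∀ s, q s = 0 ↔ q' s = 0) {η : ℝ} (hη : 0 ≤ η)
    (hlog : ∀ s, q s ≠ 0 → Real.log (q s / q' s) ≤ η) {v : S → ℝ} {H : ℝ} (hH : 0 ≤ H)
    (hv : ∀ s, v s ∈ Set.Icc 0 H) :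
    sigma (klBall q' c) v ≤ sigma (klBall q c) v + η / c * H := by
  refine sigma_le_sigma_add_of_forall_exists (klBall_subset _ _) ⟨q, self_mem_klBall hq hc.le⟩
    fun p hp => ?_
  have hcη : 0 < c + η := by linarith
  -- The weight η/(c+η) solves (1-t)(c+η) = c.
  have ht0 : 0 ≤ η / (c + η) := by positivity
  refine ⟨_, lineMap_mem_klBall hp hq' hsupp hlog ht0 ?_ ?_, ?_⟩
  · rw [div_le_one hcη]; linarith
  · apply le_of_eq; field_simp; ring
  · rw [add_dotProduct, smul_dotProduct, smul_dotProduct, smul_eq_mul, smul_eq_mul]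
    have h1 := dotProduct_mem_Icc hp.1 hv
    have h2 := dotProduct_mem_Icc hq' hv
    have h3 : η / (c + η) ≤ η / c := div_le_div_of_nonneg_left hη hc (by linarith)
    have h4 := mul_le_mul_of_nonneg_left h2.2 ht0
    have h5 := mul_le_mul_of_nonneg_right h3 hH
    have h6 := mul_nonneg ht0 h1.1
    linarith

/-- The two-sided estimate, for centres that are close on their common support. -/
theorem abs_sigma_klBall_sub_le (hc : 0 < c) (hq : q ∈ stdSimplex ℝ S)
    (hq' : q' ∈ stdSimplex ℝ S) {m t : ℝ} (hm : ∀ s, q s ≠ 0 → m ≤ q s) (ht : 0 ≤ t)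
    (hmt : 2 * t ≤ m) (hm0 : 0 < m) (hzero : ∀ s, q s = 0 → q' s = 0)
    (hclose : ∀ s, q s ≠ 0 → |q' s - q s| ≤ t) {v : S → ℝ} {H : ℝ} (hH : 0 ≤ H)
    (hv : ∀ s, v s ∈ Set.Icc 0 H) :
    |sigma (klBall q' c) v - sigma (klBall q c) v| ≤ 2 * t / m / c * H := by
  -- On the support q' ≥ m/2, so 1 - 1/x ≤ log x ≤ x - 1 at x = q'/q gives the bound 2t/m on both
  -- sides.
  have key : ∀ s, q s ≠ 0 → 0 < q' s ∧ |Real.log (q' s / q s)| ≤ 2 * t / m := by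
    intro s hs
    have h1 := hm s hs
    have h2 := abs_le.1 (hclose s hs)
    have hq0 : 0 < q s := hm0.trans_le h1
    have hq'0 : 0 < q' s := by linarith
    refine ⟨hq'0, abs_le.2 ⟨?_, ?_⟩⟩
    · have h3 := Real.one_sub_inv_le_log_of_pos (div_pos hq'0 hq0)
      refine le_trans ?_ h3
      rw [inv_div, neg_le, neg_sub, sub_le_iff_le_add, div_le_iff₀ hq'0]
      have h4 : t ≤ 2 * t / m * q' s := by
        rw [div_mul_eq_mul_div, le_div_iff₀ hm0]
        nlinarith
      linarith
    · have h3 := Real.log_le_sub_one_of_pos (div_pos hq'0 hq0)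
      refine h3.trans ?_
      rw [sub_le_iff_le_add, div_le_iff₀ hq0]
      have h4 : t ≤ 2 * t / m * q s := by
        rw [div_mul_eq_mul_div, le_div_iff₀ hm0]
        nlinarith
      linarith
  have hsupp : ∀ s, q s = 0 ↔ q' s = 0 := fun s =>
    ⟨hzero s, fun h => by_contra fun h' => (key s h').1.ne' h⟩
  have hη : 0 ≤ 2 * t / m := by positivity
  have e1 := sigma_klBall_le_add hc hq hq' hsupp hη (fun s hs => by
    rw [← inv_div, Real.log_inv]; exact (neg_le_abs _).trans (key s hs).2) hH hv
  have e2 := sigma_klBall_le_add hc hq' hq (fun s => (hsupp s).symm) hη (fun s hs =>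
    (le_abs_self _).trans (key s fun h => hs ((hsupp s).1 h)).2) hH hv
  rw [abs_le]
  constructor <;> linarith

end KLBall

/-! ### Comparison under discounting, and maxima over actions. -/

section Discounting

variable {S A : Type*} [Fintype S] {γ c : ℝ} {r : S → A → ℝ}

/-- A function that is dominated up to `d` by its discounted average is at most `d / (1 - γ)`. -/
lemma le_div_of_le_add_dotProduct (h0 : 0 ≤ γ) (h1 : γ < 1) {p : S → S → ℝ}
    (hp : ∀ s, p s ∈ stdSimplex ℝ S) {f : S → ℝ} {d : ℝ}
    (h : ∀ s, f s ≤ d + γ * (p s ⬝ᵥ f)) (s : S) : f s ≤ d / (1 - γ) := by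
  have : Nonempty S := ⟨s⟩
  obtain ⟨m, hm⟩ := Finite.exists_max f
  have h2 := dotProduct_le_dotProduct_add (v := f) (w := 0) (hp m) (k := f m) fun s => by
    simpa using hm s
  rw [dotProduct_zero, zero_add] at h2
  have h3 := mul_le_mul_of_nonneg_left h2 h0
  refine (hm s).trans ?_
  rw [le_div_iff₀ (by linarith)]
  linarith [h m]

variable [MeasurableSpace S] [MeasurableSingletonClass S] {Po : Model S A}

lemma bddBelow_value (h0 : 0 ≤ γ) (hr : ∀ s a, r s a ∈ Set.Icc (0 : ℝ) 1) (π : S → A) (s : S) :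
    BddBelow (Set.range fun P : klUncertainty Po c => value γ r π P.1 s) :=
  ⟨0, by rintro _ ⟨P, rfl⟩; exact value_nonneg h0 hr π P.1 s⟩

end Discounting

section Supremum

variable {A : Type*} [Finite A] [Nonempty A]

lemma ciSup_le_ciSup_add {f g : A → ℝ} {d : ℝ} (h : ∀ a, f a ≤ g a + d) :
    ⨆ a, f a ≤ (⨆ a, g a) + d :=
  ciSup_le fun a => (h a).trans (by gcongr; exact le_ciSup (Set.finite_range g).bddAbove a)

lemma ciSup_mem_Icc {f : A → ℝ} {a b : ℝ} (h : ∀ i, f i ∈ Set.Icc a b) :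
    ⨆ i, f i ∈ Set.Icc a b :=
  ⟨(h (Classical.arbitrary A)).1.trans (le_ciSup (Set.finite_range f).bddAbove _),
    ciSup_le fun i => (h i).2⟩

end Supremum

/-! ### The robust Bellman operator and error propagation. -/

section RobustBellman

variable {S A : Type*} [Fintype S]

/-- The robust Bellman operator on action-value functions, for KL balls around the rows of `q`. -/
noncomputable def bellmanOp (γ : ℝ) (r : S → A → ℝ) (q : S → A → S → ℝ) (c : ℝ)
    (Q : S → A → ℝ) (s : S) (a : A) : ℝ :=
  r s a + γ * sigma (klBall (q s a) c) (fun s' => ⨆ b, Q s' b)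

variable {γ c : ℝ} {r : S → A → ℝ}

section RobustValue

variable [MeasurableSpace S] [MeasurableSingletonClass S] {Po : Model S A}

/-- The robust value of a policy is at most the optimal value from the Bellman equation. -/
lemma robustValue_le [Finite A] (h0 : 0 ≤ γ) (h1 : γ < 1) (hc : 0 ≤ c)
    (hr : ∀ s a, r s a ∈ Set.Icc (0 : ℝ) 1) {Q : S → A → ℝ}
    (hQ : bellmanOp γ r (fun s a => (Po s a : S → ℝ)) c Q = Q) (π : S → A) (s : S) :
    robustValue γ r Po c π s ≤ ⨆ a, Q s a := by
  have hpos : 0 < 1 - γ := by linarith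
  refine le_of_forall_pos_le_add fun η hη => ?_
  set U : S → ℝ := fun s => ⨆ a, Q s a
  have hη' : 0 < η * (1 - γ) := mul_pos hη hpos
  -- Nearly worst rows are chosen separately for each pair; rectangularity lets them form one
  -- admissible model, so attainment of the infimum is not needed.
  choose u hu huσ using fun s a => exists_dotProduct_lt_sigma_add
    (B := klBall (Po s a : S → ℝ) c) ⟨_, self_mem_klBall (Po s a).2 hc⟩ U hη'
  let P : Model S A := fun s a => ⟨u s a, (hu s a).1⟩
  have hP : P ∈ klUncertainty Po c := fun s a => hu s a
  have hV : ∀ s, value γ r π P s - U s ≤ η := by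
    intro s
    have := le_div_of_le_add_dotProduct h0 h1 (p := fun s => u s (π s))
      (fun s => (hu s (π s)).1) (f := fun s => value γ r π P s - U s) (d := η * (1 - γ))
      (fun s => by
        have e := value_bellman h0 h1 hr π P s
        have e1 : r s (π s) + γ * sigma (klBall (Po s (π s) : S → ℝ) c) U ≤ U s :=
          (congrFun (congrFun hQ s) (π s)).trans_le (le_ciSup (Set.finite_range (Q s)).bddAbove _)
        have e2 := mul_le_mul_of_nonneg_left (huσ s (π s)).le h0
        have e3 : u s (π s) ⬝ᵥ (fun s => value γ r π P s - U s) =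
            u s (π s) ⬝ᵥ value γ r π P - u s (π s) ⬝ᵥ U := dotProduct_sub _ _ _
        have e4 : ((P s (π s) : S → ℝ) ⬝ᵥ value γ r π P) = u s (π s) ⬝ᵥ value γ r π P := rfl
        have e5 := mul_le_of_le_one_left hη'.le h1.le
        rw [e3, e, e4]
        linarith) s
    rwa [mul_div_cancel_right₀ _ hpos.ne'] at this
  refine (ciInf_le (bddBelow_value h0 hr π s) ⟨P, hP⟩).trans ?_
  linarith [hV s]

/-- The robust value of a nearly optimal policy. -/
lemma le_robustValue (h0 : 0 ≤ γ) (h1 : γ < 1) (hc : 0 ≤ c)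
    (hr : ∀ s a, r s a ∈ Set.Icc (0 : ℝ) 1) {Q : S → A → ℝ}
    (hQ : bellmanOp γ r (fun s a => (Po s a : S → ℝ)) c Q = Q) {π : S → A} {d : ℝ}
    (hπ : ∀ s, ⨆ a, Q s a ≤ Q s (π s) + d) (s : S) :
    ⨆ a, Q s a ≤ robustValue γ r Po c π s + d / (1 - γ) := by
  have : Nonempty (klUncertainty Po c) := ⟨⟨Po, fun s a => self_mem_klBall (Po s a).2 hc⟩⟩
  rw [← sub_le_iff_le_add]
  refine le_ciInf fun P => ?_
  set U : S → ℝ := fun s => ⨆ a, Q s a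
  have := le_div_of_le_add_dotProduct h0 h1 (p := fun s => (P.1 s (π s) : S → ℝ))
    (fun s => (P.1 s (π s)).2) (f := fun s => U s - value γ r π P.1 s) (d := d)
    (fun s => by
      have e := value_bellman h0 h1 hr π P.1 s
      have e1 : U s ≤ r s (π s) + γ * sigma (klBall (Po s (π s) : S → ℝ) c) U + d :=
        (hπ s).trans_eq (congrArg (· + d) (congrFun (congrFun hQ s) (π s)).symm)
      have e2 := mul_le_mul_of_nonneg_left
        (sigma_le_dotProduct (klBall_subset _ _) (P.2 s (π s)) U) h0
      have e3 : (P.1 s (π s) : S → ℝ) ⬝ᵥ (fun s => U s - value γ r π P.1 s) =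
          (P.1 s (π s) : S → ℝ) ⬝ᵥ U - (P.1 s (π s) : S → ℝ) ⬝ᵥ value γ r π P.1 :=
        dotProduct_sub _ _ _
      rw [e3, e]
      linarith) s
  linarith

end RobustValue

variable [Finite A] [Nonempty A] {q : S → A → S → ℝ}

lemma bellmanOp_le_add (h0 : 0 ≤ γ) (hc : 0 ≤ c) (hq : ∀ s a, q s a ∈ stdSimplex ℝ S)
    {Q Q' : S → A → ℝ} {d : ℝ} (h : ∀ s a, Q s a ≤ Q' s a + d) (s : S) (a : A) :
    bellmanOp γ r q c Q s a ≤ bellmanOp γ r q c Q' s a + γ * d := by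
  have := sigma_le_sigma_add (klBall_subset (q s a) c) ⟨_, self_mem_klBall (hq s a) hc⟩
    (v := fun s' => ⨆ b, Q s' b) (w := fun s' => ⨆ b, Q' s' b)
    fun s' => ciSup_le_ciSup_add (h s')
  have := mul_le_mul_of_nonneg_left this h0
  simp only [bellmanOp]
  linarith

lemma exists_bellmanOp_fixedPoint [Fintype A] (h0 : 0 ≤ γ) (h1 : γ < 1) (hc : 0 ≤ c)
    (hq : ∀ s a, q s a ∈ stdSimplex ℝ S) : ∃ Q, bellmanOp γ r q c Q = Q := by
  have hcon : ContractingWith ⟨γ, h0⟩ (bellmanOp γ r q c) := by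
    refine ⟨by exact_mod_cast h1, LipschitzWith.of_dist_le_mul fun Q Q' => ?_⟩
    have hd : ∀ (Q Q' : S → A → ℝ) s a, Q s a ≤ Q' s a + dist Q Q' := fun Q Q' s a => by
      have := (dist_le_pi_dist (Q s) (Q' s) a).trans (dist_le_pi_dist Q Q' s)
      rw [Real.dist_eq] at this
      linarith [le_abs_self (Q s a - Q' s a)]
    have hnn : 0 ≤ γ * dist Q Q' := mul_nonneg h0 dist_nonneg
    refine (dist_pi_le_iff hnn).2 fun s => (dist_pi_le_iff hnn).2 fun a => ?_
    have e1 := bellmanOp_le_add (r := r) h0 hc hq (hd Q Q') s a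
    have e2 := bellmanOp_le_add (r := r) h0 hc hq (hd Q' Q) s a
    rw [dist_comm Q' Q] at e2
    rw [Real.dist_eq, abs_le]
    constructor <;> linarith
  exact ⟨_, hcon.fixedPoint_isFixedPt⟩

lemma bellmanOp_fixedPoint_mem_Icc (h0 : 0 ≤ γ) (h1 : γ < 1) (hc : 0 ≤ c)
    (hr : ∀ s a, r s a ∈ Set.Icc (0 : ℝ) 1)
    (hq : ∀ s a, q s a ∈ stdSimplex ℝ S) {Q : S → A → ℝ} (hQ : bellmanOp γ r q c Q = Q)
    (s : S) (a : A) : Q s a ∈ Set.Icc 0 (1 / (1 - γ)) := by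
  have : Nonempty (S × A) := ⟨(s, a)⟩
  obtain ⟨⟨s₀, a₀⟩, hmin⟩ := Finite.exists_min fun x : S × A => Q x.1 x.2
  obtain ⟨⟨s₁, a₁⟩, hmax⟩ := Finite.exists_max fun x : S × A => Q x.1 x.2
  have hσ : ∀ s a, sigma (klBall (q s a) c) (fun s' => ⨆ b, Q s' b) ∈
      Set.Icc (Q s₀ a₀) (Q s₁ a₁) := fun s a =>
    sigma_mem_Icc_of_nonempty (klBall_subset _ _) ⟨_, self_mem_klBall (hq s a) hc⟩
      fun s' => ciSup_mem_Icc fun b => ⟨hmin (s', b), hmax (s', b)⟩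
  have e0 : Q s₀ a₀ = _ := (congrFun (congrFun hQ s₀) a₀).symm
  have e1 : Q s₁ a₁ = _ := (congrFun (congrFun hQ s₁) a₁).symm
  simp only [bellmanOp] at e0 e1
  have l0 := mul_le_mul_of_nonneg_left (hσ s₀ a₀).1 h0
  have l1 := mul_le_mul_of_nonneg_left (hσ s₁ a₁).2 h0
  constructor
  · have : 0 ≤ Q s₀ a₀ := by nlinarith [(hr s₀ a₀).1]
    exact this.trans (hmin (s, a))
  · refine (hmax (s, a)).trans ?_
    rw [le_div_iff₀ (by linarith)]
    linarith [(hr s₁ a₁).2]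

lemma reviQ_mem_Icc (h0 : 0 ≤ γ) (h1 : γ < 1) (hr : ∀ s a, r s a ∈ Set.Icc (0 : ℝ) 1)
    (k : ℕ) (s : S) (a : A) : reviQ γ r q c k s a ∈ Set.Icc 0 (1 / (1 - γ)) := by
  have hpos : 0 < 1 - γ := by linarith
  induction k generalizing s a with
  | zero => exact ⟨le_rfl, by simp only [reviQ]; positivity⟩
  | succ k ih =>
    have hσ := sigma_mem_Icc (klBall_subset (q s a) c) (by positivity)
      fun s' => ciSup_mem_Icc (ih s')
    have l0 := mul_nonneg h0 hσ.1
    have l1 := mul_le_mul_of_nonneg_left hσ.2 h0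
    have e : 1 + γ * (1 / (1 - γ)) = 1 / (1 - γ) := by field_simp; ring
    rw [reviQ]
    exact ⟨by linarith [(hr s a).1], by linarith [(hr s a).2]⟩

variable {q' : S → A → S → ℝ}

/-- Robust value iteration with a perturbed model stays close to the optimal action values. -/
lemma reviQ_close (h0 : 0 ≤ γ) (h1 : γ < 1) (hc : 0 ≤ c)
    (hr : ∀ s a, r s a ∈ Set.Icc (0 : ℝ) 1) (hq : ∀ s a, q s a ∈ stdSimplex ℝ S)
    {Q : S → A → ℝ} (hQ : bellmanOp γ r q c Q = Q) {Δ : ℝ} (hΔ0 : 0 ≤ Δ)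
    (hΔ : ∀ s a, ∀ v : S → ℝ, (∀ s', v s' ∈ Set.Icc 0 (1 / (1 - γ))) →
      |sigma (klBall (q' s a) c) v - sigma (klBall (q s a) c) v| ≤ Δ) (k : ℕ) (s : S) (a : A) :
    reviQ γ r q' c k s a ≤ Q s a + γ * Δ / (1 - γ) ∧
    Q s a ≤ reviQ γ r q' c k s a + (γ * Δ / (1 - γ) + γ ^ k / (1 - γ)) := by
  have hpos : 0 < 1 - γ := by linarith
  -- The bound γΔ/(1-γ) is the fixed point of the error recursion d ↦ γd + γΔ. The term γ^k/(1-γ)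
  -- enters on one side only, because the iteration starts at 0, below `Q`.
  have hβ : γ * (γ * Δ / (1 - γ)) + γ * Δ = γ * Δ / (1 - γ) := by field_simp; ring
  have hβ0 : 0 ≤ γ * Δ / (1 - γ) := by positivity
  induction k generalizing s a with
  | zero =>
    have := bellmanOp_fixedPoint_mem_Icc h0 h1 hc hr hq hQ s a
    simp only [reviQ, pow_zero]
    exact ⟨by linarith [this.1], by linarith [this.2]⟩
  | succ k ih =>
    have hd := abs_le.1 (hΔ s a (fun s' => ⨆ b, reviQ γ r q' c k s' b)
      fun s' => ciSup_mem_Icc (reviQ_mem_Icc h0 h1 hr k s'))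
    have hd1 := mul_le_mul_of_nonneg_left hd.1 h0
    have hd2 := mul_le_mul_of_nonneg_left hd.2 h0
    have e : reviQ γ r q' c (k + 1) s a = bellmanOp γ r q c (reviQ γ r q' c k) s a +
        γ * (sigma (klBall (q' s a) c) (fun s' => ⨆ b, reviQ γ r q' c k s' b) -
          sigma (klBall (q s a) c) fun s' => ⨆ b, reviQ γ r q' c k s' b) := by
      simp only [reviQ, bellmanOp]; ring
    have u1 := bellmanOp_le_add (r := r) h0 hc hq (fun s a => (ih s a).1) s a
    have u2 := bellmanOp_le_add (r := r) h0 hc hq (fun s a => (ih s a).2) s a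
    rw [hQ] at u1 u2
    have hk : γ ^ (k + 1) / (1 - γ) = γ * (γ ^ k / (1 - γ)) := by ring
    rw [e, hk]
    constructor <;> linarith

variable [MeasurableSpace S] [MeasurableSingletonClass S] {Po : Model S A}

/-- Suboptimality of the output of robust value iteration with a perturbed model. -/
theorem norm_optRobustValue_sub_le [Fintype A] (h0 : 0 ≤ γ) (h1 : γ < 1) (hc : 0 ≤ c)
    (hr : ∀ s a, r s a ∈ Set.Icc (0 : ℝ) 1) {Δ : ℝ} (hΔ0 : 0 ≤ Δ)
    (hΔ : ∀ s a, ∀ v : S → ℝ, (∀ s', v s' ∈ Set.Icc 0 (1 / (1 - γ))) →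
      |sigma (klBall (q' s a) c) v - sigma (klBall (Po s a : S → ℝ) c) v| ≤ Δ)
    {K : ℕ} {π : S → A} (hπ : IsGreedy (reviQ γ r q' c K) π) :
    ‖optRobustValue γ r Po c - robustValue γ r Po c π‖ ≤
      γ ^ K / (1 - γ) ^ 2 + 2 * (γ * Δ) / (1 - γ) ^ 2 := by
  have hpos : 0 < 1 - γ := by linarith
  obtain ⟨Q, hQ⟩ := exists_bellmanOp_fixedPoint (r := r) h0 h1 hc fun s a => (Po s a).2
  have hclose := reviQ_close h0 h1 hc hr (fun s a => (Po s a).2) hQ hΔ0 hΔ K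
  refine (pi_norm_le_iff_of_nonneg (by positivity)).2 fun s => ?_
  have hfin : BddAbove (Set.range fun π => robustValue γ r Po c π s) :=
    (Set.finite_range _).bddAbove
  have e1 : robustValue γ r Po c π s ≤ optRobustValue γ r Po c s := le_ciSup hfin π
  have e2 : optRobustValue γ r Po c s ≤ ⨆ a, Q s a :=
    ciSup_le fun π => robustValue_le h0 h1 hc hr hQ π s
  -- A greedy action loses at most the sum of the lower and upper errors of the iterate;
  -- `le_robustValue` divides this loss by 1 - γ once more.
  have e3 := le_robustValue h0 h1 hc hr hQ (π := π)
    (d := γ ^ K / (1 - γ) + 2 * (γ * Δ) / (1 - γ)) (fun s => ciSup_le fun a => by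
      have a1 := (hclose s a).2
      have a2 := (hclose s (π s)).1
      have a3 := hπ s a
      have a4 : 2 * (γ * Δ) / (1 - γ) = γ * Δ / (1 - γ) + γ * Δ / (1 - γ) := by ring
      linarith) s
  have e4 : (γ ^ K / (1 - γ) + 2 * (γ * Δ) / (1 - γ)) / (1 - γ) =
      γ ^ K / (1 - γ) ^ 2 + 2 * (γ * Δ) / (1 - γ) ^ 2 := by field_simp
  rw [Pi.sub_apply, Real.norm_of_nonneg (by linarith)]
  linarith

end RobustBellman

/-! ### Concentration of the empirical model. -/

section Hoeffding

variable {Ω : Type*} [MeasurableSpace Ω] {μ : Measure Ω} [IsProbabilityMeasure μ]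

/-- Two-sided Hoeffding inequality for the sum of independent variables in `[0, 1]` with the same
mean. -/
lemma measureReal_lt_abs_sum_div_sub_le {N : ℕ} (hN : 0 < N) {Y : Fin N → Ω → ℝ}
    (hm : ∀ i, Measurable (Y i)) (hind : iIndepFun Y μ)
    (hY : ∀ i ω, Y i ω ∈ Set.Icc (0 : ℝ) 1) {p : ℝ} (hp : ∀ i, ∫ ω, Y i ω ∂μ = p)
    {t : ℝ} (ht : 0 ≤ t) :
    μ.real {ω | t < |(∑ i, Y i ω) / N - p|} ≤ 2 * Real.exp (-(2 * N * t ^ 2)) := by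
  have hN' : (0 : ℝ) < N := by exact_mod_cast hN
  have hsub : ∀ i, HasSubgaussianMGF (fun ω => Y i ω - p) ((‖(1 : ℝ) - 0‖₊ / 2) ^ 2) μ := by
    intro i
    have := hasSubgaussianMGF_of_mem_Icc (μ := μ) (hm i).aemeasurable
      (Filter.Eventually.of_forall (hY i))
    rwa [hp i] at this
  have hind1 : iIndepFun (fun i ω => Y i ω - p) μ :=
    hind.comp (fun _ x => x - p) fun _ => measurable_id.sub_const p
  have hind2 : iIndepFun (fun i ω => -(Y i ω - p)) μ :=
    hind1.comp (fun _ x => -x) fun _ => measurable_neg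
  -- Each variable is sub-Gaussian with parameter 1/4, hence the sum with N/4.
  have hexp : -((N : ℝ) * t) ^ 2 / (2 * ((∑ _i : Fin N, (‖(1 : ℝ) - 0‖₊ / 2) ^ 2 : NNReal) : ℝ))
      = -(2 * N * t ^ 2) := by
    simp
    field_simp
  have e1 := HasSubgaussianMGF.measure_sum_ge_le_of_iIndepFun hind1 (s := Finset.univ)
    (fun i _ => hsub i) (mul_nonneg hN'.le ht)
  have e2 := HasSubgaussianMGF.measure_sum_ge_le_of_iIndepFun hind2 (s := Finset.univ)
    (fun i _ => (hsub i).neg) (mul_nonneg hN'.le ht)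
  rw [hexp] at e1 e2
  refine (measureReal_mono (s₂ := {ω | (N : ℝ) * t ≤ ∑ i, (Y i ω - p)} ∪
    {ω | (N : ℝ) * t ≤ ∑ i, -(Y i ω - p)}) ?_).trans
    ((measureReal_union_le _ _).trans (by linarith))
  intro ω hω
  have hs : ∑ i, (Y i ω - p) = N * ((∑ i, Y i ω) / N - p) := by
    rw [Finset.sum_sub_distrib]
    simp
    field_simp
  simp only [Set.mem_union, Set.mem_ofPred_eq, Finset.sum_neg_distrib, hs] at hω ⊢
  rcases lt_abs.1 hω with h | h
  · exact Or.inl (mul_le_mul_of_nonneg_left h.le hN'.le)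
  · right
    rw [← mul_neg]
    exact mul_le_mul_of_nonneg_left h.le hN'.le

end Hoeffding

section Empirical

variable {S A : Type*} {N : ℕ}

open scoped Classical in
lemma empirical_eq_sum (x : S → A → Fin N → S) (s : S) (a : A) (s' : S) :
    empirical x s a s' = (∑ i, if x s a i = s' then (1 : ℝ) else 0) / N := by
  rw [empirical, Finset.sum_boole]

variable [Fintype S]

lemma empirical_mem_stdSimplex (hN : 0 < N) (x : S → A → Fin N → S) (s : S) (a : A) :
    empirical x s a ∈ stdSimplex ℝ S := by
  classical
  have hN' : (N : ℝ) ≠ 0 := by exact_mod_cast hN.ne'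
  refine ⟨fun s' => by unfold empirical; positivity, ?_⟩
  simp only [empirical_eq_sum]
  rw [← Finset.sum_div, Finset.sum_comm]
  simp [hN']

variable {Ω : Type*} [MeasurableSpace Ω] {μ : Measure Ω} [MeasurableSpace S] {Po : Model S A} {X : S → A → Fin N → Ω → S}

namespace IsGenerativeSample

lemma measureReal_empirical_ne_zero (h : IsGenerativeSample Po μ X) {s : S} {a : A} {s' : S}
    (h0 : Po s a s' = 0) :
    μ.real {ω | empirical (fun s a i => X s a i ω) s a s' ≠ 0} = 0 := by
  classical
  have hz : μ (⋃ i, X s a i ⁻¹' {s'}) = 0 :=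
    measure_iUnion_null fun i => by rw [h.law, h0, ENNReal.ofReal_zero]
  rw [Measure.real, measure_mono_null (fun ω hω => ?_) hz, ENNReal.toReal_zero]
  by_contra hn
  refine hω ?_
  simp only [Set.mem_iUnion, Set.mem_preimage, Set.mem_singleton_iff, not_exists] at hn
  simp [empirical_eq_sum, hn]

variable [IsProbabilityMeasure μ] [MeasurableSingletonClass S]

lemma measureReal_lt_abs_empirical_sub_le (h : IsGenerativeSample Po μ X) (hN : 0 < N)
    (s : S) (a : A) (s' : S) {t : ℝ} (ht : 0 ≤ t) :
    μ.real {ω | t < |empirical (fun s a i => X s a i ω) s a s' - Po s a s'|} ≤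
      2 * Real.exp (-(2 * N * t ^ 2)) := by
  classical
  let g : S → ℝ := fun y => if y = s' then 1 else 0
  have hg : Measurable g := measurable_of_finite g
  have hX : iIndepFun (fun i : Fin N => X s a i) μ :=
    h.indep.precomp (g := fun i : Fin N => (s, a, i)) fun i j hij => by simpa using hij
  have hp : ∀ i, ∫ ω, g (X s a i ω) ∂μ = Po s a s' := by
    intro i
    have e : (fun ω => g (X s a i ω)) = (X s a i ⁻¹' {s'}).indicator 1 := by
      ext ω
      simp [g, Set.indicator_apply]
    rw [e, integral_indicator_one (h.measurable s a i (measurableSet_singleton s')),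
      Measure.real, h.law]
    exact ENNReal.toReal_ofReal ((Po s a).2.1 s')
  have := measureReal_lt_abs_sum_div_sub_le hN (Y := fun i ω => g (X s a i ω))
    (fun i => hg.comp (h.measurable s a i)) (hX.comp (fun _ => g) fun _ => hg)
    (fun i ω => by by_cases hx : X s a i ω = s' <;> simp [g, hx]) hp ht
  simpa only [empirical_eq_sum] using this

/-- With high probability, the empirical model is uniformly close to the nominal one and charges
no transition that is impossible under the nominal model. -/
theorem le_measure_empirical_close [Fintype A] (h : IsGenerativeSample Po μ X) (hN : 0 < N)
    {t δ : ℝ} (ht : 0 ≤ t)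
    (hδ : (Fintype.card S : ℝ) ^ 2 * Fintype.card A * Real.exp (-(2 * N * t ^ 2)) ≤ δ) :
    ENNReal.ofReal (1 - 2 * δ) ≤ μ {ω | ∀ s a s',
      (Po s a s' = 0 → empirical (fun s a i => X s a i ω) s a s' = 0) ∧
      (Po s a s' ≠ 0 → |empirical (fun s a i => X s a i ω) s a s' - Po s a s'| ≤ t)} := by
  set G := {ω | ∀ s a s',
      (Po s a s' = 0 → empirical (fun s a i => X s a i ω) s a s' = 0) ∧
      (Po s a s' ≠ 0 → |empirical (fun s a i => X s a i ω) s a s' - Po s a s'| ≤ t)}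
  let bad : S × A × S → Set Ω := fun j => {ω | ¬
      ((Po j.1 j.2.1 j.2.2 = 0 → empirical (fun s a i => X s a i ω) j.1 j.2.1 j.2.2 = 0) ∧
      (Po j.1 j.2.1 j.2.2 ≠ 0 →
        |empirical (fun s a i => X s a i ω) j.1 j.2.1 j.2.2 - Po j.1 j.2.1 j.2.2| ≤ t))}
  have hbad : ∀ j, μ.real (bad j) ≤ 2 * Real.exp (-(2 * N * t ^ 2)) := by
    rintro ⟨s, a, s'⟩
    by_cases h0 : Po s a s' = 0
    · refine (measureReal_mono (s₂ := {ω | empirical (fun s a i => X s a i ω) s a s' ≠ 0}) ?_).trans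
        ((h.measureReal_empirical_ne_zero h0).trans_le (by positivity))
      intro ω hω
      simpa [bad, h0] using hω
    · refine (measureReal_mono ?_).trans (h.measureReal_lt_abs_empirical_sub_le hN s a s' ht)
      intro ω hω
      simpa [bad, h0] using hω
  have hsub : Gᶜ ⊆ ⋃ j, bad j := by
    intro ω hω
    by_contra hn
    refine hω fun s a s' => ?_
    by_contra hc
    exact hn (Set.mem_iUnion.2 ⟨(s, a, s'), hc⟩)
  have hcompl : μ.real Gᶜ ≤ 2 * δ := by
    refine (measureReal_mono hsub).trans ((measureReal_iUnion_fintype_le _).trans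
      ((Finset.sum_le_sum fun j _ => hbad j).trans ?_))
    simp only [Finset.sum_const, Finset.card_univ, Fintype.card_prod, nsmul_eq_mul]
    push_cast
    nlinarith
  -- Subadditivity suffices here, so `G` need not be shown measurable.
  have hone : 1 ≤ μ.real G + μ.real Gᶜ := by
    have := measureReal_union_le (μ := μ) G Gᶜ
    rwa [Set.union_compl_self, probReal_univ] at this
  rw [ENNReal.ofReal_le_iff_le_toReal (measure_ne_top _ _)]
  change _ ≤ μ.real G
  linarith

end IsGenerativeSample

end Empirical

/-! ### Consequences of the iteration and sample counts. -/

section SampleSize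

lemma exists_pos_le_of_ne_zero {ι : Type*} [Finite ι] (f : ι → ℝ) (hf : ∀ i, 0 ≤ f i) :
    ∃ m, 0 < m ∧ ∀ i, f i ≠ 0 → m ≤ f i := by
  rcases isEmpty_or_nonempty {i // f i ≠ 0} with h | h
  · exact ⟨1, one_pos, fun i hi => (h.false ⟨i, hi⟩).elim⟩
  · obtain ⟨i₀, hi₀⟩ := Finite.exists_min fun i : {i // f i ≠ 0} => f i
    exact ⟨f i₀, lt_of_le_of_ne (hf _) (Ne.symm i₀.2), fun i hi => hi₀ ⟨i, hi⟩⟩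

variable {γ ε δ c lam : ℝ}

lemma pow_div_le_of_K0_le (h0 : 0 < γ) (h1 : γ < 1) (hε : 0 < ε) {K : ℕ}
    (hK : K0 γ ε ≤ K) : γ ^ K / (1 - γ) ^ 2 ≤ ε / 2 := by
  have hpos : 0 < 1 - γ := by linarith
  have hM : (2 : ℝ) ≤ max (8 * γ) 2 := le_max_right _ _
  have hlog : 0 < Real.log (1 / γ) := Real.log_pos ((one_lt_div h0).2 h1)
  rw [K0, one_div_mul_eq_div, div_le_iff₀ hlog] at hK
  have h2 := Real.exp_le_exp.2 hK
  rw [Real.exp_log (by positivity), ← Real.log_pow, Real.exp_log (by positivity),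
    one_div, inv_pow, div_le_iff₀ (by positivity), inv_mul_eq_div,
    le_div_iff₀ (by positivity)] at h2
  rw [div_le_iff₀ (by positivity)]
  nlinarith [pow_pos h0 K]

/-- The union bound has a factor n², while the logarithm contains n only once; `lam ≤ 9 / n` absorbs
the other factor. -/
lemma card_mul_exp_neg_log_le {n k : ℕ} (hn : 0 < n) (hk : 0 < k) (h1 : γ < 1) (h0 : 0 < γ) (hδ : 0 < δ)
    (hlam : 0 < lam) (hlamn : lam ≤ 9 / n) :
    (n : ℝ) ^ 2 * k * Real.exp (-Real.log (9 * n * k / (δ * lam * (1 - γ)))) ≤ δ := by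
  have hpos : 0 < 1 - γ := by linarith
  have hn' : (0 : ℝ) < n := by exact_mod_cast hn
  have hk' : (0 : ℝ) < k := by exact_mod_cast hk
  rw [Real.exp_neg, Real.exp_log (by positivity), inv_div, ← mul_div_assoc,
    div_le_iff₀ (by positivity)]
  rw [le_div_iff₀ hn'] at hlamn
  have h2 : lam * n * (1 - γ) ≤ 9 := by nlinarith [mul_pos hlam hn']
  have h3 : 0 ≤ n * k * δ := by positivity
  nlinarith

/-- The accuracy of the empirical model guaranteed by the sample size `Nkl`. -/
lemma sqrt_div_le_of_Nkl_le {n k N : ℕ} (hn : 0 < n) (h0 : 0 < γ) (h1 : γ < 1) (hc : 0 < c)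
    (hε : 0 < ε) (hlam : 0 < lam) (hN0 : 0 < N)
    (hL : 0 ≤ Real.log (9 * n * k / (δ * lam * (1 - γ)))) (hN : Nkl n k c γ ε δ lam ≤ N) :
    Real.sqrt (Real.log (9 * n * k / (δ * lam * (1 - γ))) / (2 * N)) ≤
      c * lam * (1 - γ) ^ 3 * ε / (8 * γ) := by
  set L := Real.log (9 * n * k / (δ * lam * (1 - γ))) with hLdef
  have hpos : 0 < 1 - γ := by linarith
  have hn' : (1 : ℝ) ≤ n := by exact_mod_cast hn
  have hN' : (0 : ℝ) < N := by exact_mod_cast hN0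
  -- From y ≤ exp y, squared, at y = 2/(lam(1-γ)); the summand 2 lam in the exponent is discarded.
  have hE : (2 / (lam * (1 - γ))) ^ 2 ≤ Real.exp ((2 * lam + 4) / (lam * (1 - γ))) := by
    have hy : 2 / (lam * (1 - γ)) ≤ Real.exp (2 / (lam * (1 - γ))) := by
      linarith [Real.add_one_le_exp (2 / (lam * (1 - γ)))]
    calc _ ≤ Real.exp (2 / (lam * (1 - γ))) ^ 2 := pow_le_pow_left₀ (by positivity) hy 2
      _ = Real.exp (4 / (lam * (1 - γ))) := by rw [← Real.exp_nat_mul]; congr 1; push_cast; ring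
      _ ≤ _ := by
        refine Real.exp_le_exp.2 ?_
        gcongr
        linarith
  have hlow : 32 * γ ^ 2 * L / (c ^ 2 * lam ^ 2 * (1 - γ) ^ 6 * ε ^ 2) ≤ N := by
    refine le_trans ?_ hN
    rw [Nkl, ← hLdef]
    calc _ = 8 * γ ^ 2 * 1 / (c ^ 2 * (1 - γ) ^ 4 * ε ^ 2) * (2 / (lam * (1 - γ))) ^ 2 * L := by
          field_simp; ring
      _ ≤ _ := by gcongr
  refine Real.sqrt_le_iff.2 ⟨by positivity, ?_⟩
  rw [div_le_iff₀ (by positivity)] at hlow ⊢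
  have e : (c * lam * (1 - γ) ^ 3 * ε / (8 * γ)) ^ 2 * (2 * N) =
      N * (c ^ 2 * lam ^ 2 * (1 - γ) ^ 6 * ε ^ 2) / (32 * γ ^ 2) := by
    field_simp; ring
  rw [e, le_div_iff₀ (by positivity)]
  linarith

end SampleSize

end RobustMDP

/-! ### The main theorem. -/

open RobustMDP in
theorem theorem3 {S A : Type*} [Fintype S] [Fintype A] [Nonempty A]
    [MeasurableSpace S] [MeasurableSingletonClass S]
    (Po : RobustMDP.Model S A) (c : ℝ) (hc : 0 < c) :
    ∃ lam : ℝ, 0 < lam ∧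
      ∀ (γ : ℝ) (r : S → A → ℝ), 0 < γ → γ < 1 → (∀ s a, 0 ≤ r s a ∧ r s a ≤ 1) →
      ∀ δ ε : ℝ, 0 < δ → δ < 1 → 0 < ε → ε < 1 / (1 - γ) →
      ∀ K N : ℕ, RobustMDP.K0 γ ε ≤ (K : ℝ) →
        RobustMDP.Nkl (Fintype.card S) (Fintype.card A) c γ ε δ lam ≤ (N : ℝ) →
      ∀ (Ω : Type*) [MeasurableSpace Ω] (μ : MeasureTheory.Measure Ω)
        [MeasureTheory.IsProbabilityMeasure μ] (X : S → A → Fin N → Ω → S),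
        RobustMDP.IsGenerativeSample Po μ X →
        ENNReal.ofReal (1 - 2 * δ) ≤
          μ {ω | ∀ π : S → A,
            RobustMDP.IsGreedy
              (RobustMDP.reviQ γ r (RobustMDP.empirical fun s a i => X s a i ω) c K) π →
            ‖RobustMDP.optRobustValue γ r Po c - RobustMDP.robustValue γ r Po c π‖ ≤ ε} := by
  obtain ⟨m, hm0, hm⟩ := exists_pos_le_of_ne_zero (fun j : S × A × S => Po j.1 j.2.1 j.2.2)
    fun j => (Po j.1 j.2.1).2.1 j.2.2
  rcases isEmpty_or_nonempty S with hS | hS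
  · refine ⟨1, one_pos, fun γ r _ _ _ δ ε hδ _ hε _ K N _ _ Ω _ μ _ X _ => ?_⟩
    have huniv : ∀ ω ∈ Set.univ, ω ∈ {ω | ∀ π : S → A,
        IsGreedy (reviQ γ r (empirical fun s a i => X s a i ω) c K) π →
        ‖optRobustValue γ r Po c - robustValue γ r Po c π‖ ≤ ε} := fun ω _ π _ => by
      rw [Subsingleton.elim (optRobustValue γ r Po c - robustValue γ r Po c π) 0, norm_zero]
      exact hε.le
    rw [Set.univ_subset_iff.1 huniv, measure_univ]
    exact ENNReal.ofReal_le_one.2 (by linarith)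
  have hn : 0 < Fintype.card S := Fintype.card_pos
  have hk : 0 < Fintype.card A := Fintype.card_pos
  have hn' : (1 : ℝ) ≤ Fintype.card S := by exact_mod_cast hn
  have hk' : (1 : ℝ) ≤ Fintype.card A := by exact_mod_cast hk
  -- The bound 9/|S| is for the union bound, m for the final accuracy, and m/c for keeping the
  -- empirical support equal to the nominal one.
  obtain ⟨lam, hlam0, hlamn, hlamm, hlamc⟩ : ∃ lam : ℝ, 0 < lam ∧
      lam ≤ 9 / Fintype.card S ∧ lam ≤ m ∧ lam ≤ m / c :=
    ⟨min (9 / Fintype.card S) (min m (m / c)), by positivity, min_le_left _ _,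
      (min_le_right _ _).trans (min_le_left _ _), (min_le_right _ _).trans (min_le_right _ _)⟩
  refine ⟨lam, hlam0, fun γ r h0 h1 hr δ ε hδ hδ1 hε _ K N hK hN Ω _ μ _ X hX => ?_⟩
  have hpos : 0 < 1 - γ := by linarith
  have hexpL := card_mul_exp_neg_log_le hn hk h1 h0 hδ hlam0 hlamn
  set L := Real.log (9 * Fintype.card S * Fintype.card A / (δ * lam * (1 - γ))) with hLdef
  -- If L ≤ 0, then |S|²|A| exp(-L) would be at least 1, but it is at most δ < 1.
  have hL : 0 < L := by
    by_contra hL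
    have e1 : 1 ≤ Real.exp (-L) := Real.one_le_exp (by linarith)
    have e2 : (1 : ℝ) ≤ (Fintype.card S : ℝ) ^ 2 * Fintype.card A :=
      one_le_mul_of_one_le_of_one_le (one_le_pow₀ hn') hk'
    nlinarith
  have hN0 : 0 < N := by
    have : 0 < Nkl (Fintype.card S) (Fintype.card A) c γ ε δ lam := by
      rw [Nkl, ← hLdef]; positivity
    exact_mod_cast this.trans_le hN
  have hN0' : (0 : ℝ) < N := by exact_mod_cast hN0
  have htle := sqrt_div_le_of_Nkl_le hn h0 h1 hc hε hlam0 hN0 hL.le hN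
  rw [← hLdef] at htle
  -- Chosen so that the Hoeffding exponent 2Nt² equals L.
  set t := Real.sqrt (L / (2 * N)) with htdef
  have ht0 : 0 ≤ t := Real.sqrt_nonneg _
  have htL : 2 * N * t ^ 2 = L := by
    rw [htdef, Real.sq_sqrt (by positivity)]; field_simp
  have hiter := pow_div_le_of_K0_le h0 h1 hε hK
  refine (hX.le_measure_empirical_close hN0 ht0 (by rwa [htL])).trans (measure_mono ?_)
  intro ω hω π hπ
  have hH : 0 ≤ 1 / (1 - γ) := by positivity
  -- For large ε the empirical model is irrelevant: the trivial error Δ = 1/(1-γ) already suffices.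
  -- Otherwise ε(1-γ)³ < 4γ, which forces 2t ≤ c lam ≤ m, as the perturbation bound requires.
  rcases le_or_gt (4 * γ) (ε * (1 - γ) ^ 3) with hcase | hcase
  · refine (norm_optRobustValue_sub_le h0.le h1 hc.le hr hH (fun s a v hv => ?_) hπ).trans ?_
    · have b1 := sigma_mem_Icc (klBall_subset (empirical (fun s a i => X s a i ω) s a) c) hH hv
      have b2 := sigma_mem_Icc (klBall_subset (Po s a) c) hH hv
      exact abs_sub_le_of_nonneg_of_le b1.1 b1.2 b2.1 b2.2
    · have : 2 * (γ * (1 / (1 - γ))) / (1 - γ) ^ 2 ≤ ε / 2 := by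
        have e : 2 * (γ * (1 / (1 - γ))) / (1 - γ) ^ 2 = 2 * γ / (1 - γ) ^ 3 := by field_simp
        rw [e, div_le_iff₀ (by positivity)]
        linarith
      linarith
  · have ht8 : t * (8 * γ) ≤ c * lam * ((1 - γ) ^ 3 * ε) := by
      rw [le_div_iff₀ (by positivity)] at htle
      linarith
    have hcl : c * lam ≤ m := by
      rw [le_div_iff₀ hc] at hlamc
      linarith
    have htm : 2 * t ≤ m := by
      have : c * lam * ((1 - γ) ^ 3 * ε) ≤ c * lam * (4 * γ) :=
        mul_le_mul_of_nonneg_left (by linarith) (by positivity)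
      nlinarith
    have hη : 0 ≤ 2 * t / m / c * (1 / (1 - γ)) := by positivity
    refine (norm_optRobustValue_sub_le h0.le h1 hc.le hr hη (fun s a v hv =>
      abs_sigma_klBall_sub_le hc (Po s a).2 (empirical_mem_stdSimplex hN0 _ s a)
        (fun s' hs' => hm (s, a, s') hs') ht0 htm hm0 (fun s' => (hω s a s').1)
        (fun s' => (hω s a s').2) hH hv) hπ).trans ?_
    have : 2 * (γ * (2 * t / m / c * (1 / (1 - γ)))) / (1 - γ) ^ 2 ≤ ε / 2 := by
      have e : 2 * (γ * (2 * t / m / c * (1 / (1 - γ)))) / (1 - γ) ^ 2 =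
          4 * γ * t / (m * c * (1 - γ) ^ 3) := by field_simp; ring
      rw [e, div_le_iff₀ (by positivity)]
      have : c * lam * ((1 - γ) ^ 3 * ε) ≤ c * m * ((1 - γ) ^ 3 * ε) := by gcongr
      linarith
    linarith
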